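/- A \emph{continuum} is a compact connected Hausdorff space with more than one point. The \emph{weight} $w(X)$ of a topological space $X$ is the least cardinality of a base of its topology, and its \emph{size} is the cardinality $|X|$. An infinite space $X$ is \emph{balanced} if $|U| = |X|$ and $w(U) = w(X)$ for every nonempty open subspace $U$ of $X$. Let $\kappa$ be an infinite cardinal. (a) Let $J$ be a pathwise connected continuum with $w(J) \le \kappa$. Then there exist $2^{\kappa}$ mutually non-homeomorphic pathwise connected continua $X_J$ of weight $\kappa$ and size $\max\{\kappa, |J|\}$, such that all the spaces $X_J$ are balanced if $J$ is balanced and $w(J) = \kappa$. (b) Consequently, there exist, up to homeomorphism, precisely $2^{\kappa}$ pathwise connected balanced continua of weight $\kappa$ and size $2^{\kappa}$. -/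

import Mathlib

open Cardinal

universe u

namespace CountingContinua

/-- The weight `w(X)` of a topological space: the least cardinality of a base of its topology. -/
noncomputable def weight (X : Type u) [TopologicalSpace X] : Cardinal.{u} :=
  sInf {c : Cardinal.{u} | ∃ B : Set (Set X), TopologicalSpace.IsTopologicalBasis B ∧ #B = c}

/-- A continuum is a compact connected Hausdorff space with more than one point. -/
structure IsContinuum (X : Type u) [TopologicalSpace X] : Prop where
  compact : CompactSpace X
  hausdorff : T2Space X
  connected : ConnectedSpace X
  nontrivial : Nontrivial X

/-- A pathwise connected continuum of weight `κ` and size `lam`. -/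
structure IsPathContinuum (κ lam : Cardinal.{u}) (X : Type u) [TopologicalSpace X] : Prop where
  continuum : IsContinuum X
  pathConnected : PathConnectedSpace X
  weight_eq : weight X = κ
  size_eq : #X = lam

/-- An infinite space is balanced if each of its nonempty open subspaces has the same size and the
same weight as the whole space. -/
structure Balanced (X : Type u) [TopologicalSpace X] : Prop where
  infinite : Infinite X
  size_eq : ∀ U : Set X, IsOpen U → U.Nonempty → #U = #X
  weight_eq : ∀ U : Set X, IsOpen U → U.Nonempty → weight U = weight X

/-- The members of a family of topological spaces are mutually non-homeomorphic. -/
def MutuallyNonHomeomorphic {I : Type u} (X : I → Type u) [∀ i, TopologicalSpace (X i)] : Prop :=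
  ∀ i j : I, i ≠ j → IsEmpty (X i ≃ₜ X j)

end CountingContinua

-- A continuum is built from a set `A` of `κ` indices so that its topology remembers `A`. The
-- indices label pairwise non-homeomorphic compact totally disconnected spaces `Z i`, the ordinal
-- segments `[0, ω ^ a]`, told apart by Cantor–Bendixson derivatives. Collapsing `Z i × {p}` in `Z i
-- × J²` gives `Y i`, a fan of copies of `J²` (its blades) with apex `c i`. A square minus a point
-- is connected, so the components of `Y i` minus its apex form a copy of `Z i`. The `Y i` with `i ∈
-- A` are glued into a compact bouquet at points other than the apexes. Deleting the apex `c i`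
-- leaves component space `Z i`; deleting the base point leaves infinitely many clopen pieces, which
-- no compact component space allows; deleting any other point leaves a connected set. Hence the
-- spaces `Z i` with `i ∈ A`, and so `A`, can be recovered (`isComplComponentSpace_bouquet`,
-- `eq_of_isComplComponentSpace_bouquet`). Every point lies on an embedded copy of `J`, which
-- transfers balancedness. For (b), take `J` to be the Tychonoff cube. There are no more than `2 ^
-- κ` types because every compact Hausdorff space of weight `κ` is a closed subset of that cube,
-- which has at most `2 ^ κ` closed subsets.

namespace CountingContinua

open TopologicalSpace Set Topology

-- Weight of compact Hausdorff spaces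

section Weight

variable {X Y : Type u} [TopologicalSpace X] [TopologicalSpace Y]

theorem exists_basis_card_eq_weight (X : Type u) [TopologicalSpace X] :
    ∃ B : Set (Set X), IsTopologicalBasis B ∧ #B = weight X :=
  csInf_mem (s := {c : Cardinal.{u} | ∃ B : Set (Set X), IsTopologicalBasis B ∧ #B = c})
    ⟨_, _, isTopologicalBasis_opens, rfl⟩

theorem weight_le_of_isTopologicalBasis {B : Set (Set X)} (hB : IsTopologicalBasis B) :
    weight X ≤ #B :=
  csInf_le' ⟨B, hB, rfl⟩

theorem weight_le_of_isInducing {f : X → Y} (hf : IsInducing f) : weight X ≤ weight Y := by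
  obtain ⟨B, hB, hBc⟩ := exists_basis_card_eq_weight Y
  rw [← hBc]
  have hB' : IsTopologicalBasis (preimage f '' B) := by
    rw [hf.eq_induced]
    exact hB.induced f
  exact (weight_le_of_isTopologicalBasis hB').trans mk_image_le

theorem weight_eq_of_homeomorph (h : X ≃ₜ Y) : weight X = weight Y :=
  le_antisymm (weight_le_of_isInducing h.isInducing) (weight_le_of_isInducing h.symm.isInducing)

theorem weight_le_of_eq_generateFrom {κ : Cardinal.{u}} (hκ : ℵ₀ ≤ κ) {X : Type u}
    [t : TopologicalSpace X] {S : Set (Set X)} (hS : t = generateFrom S) (hSc : #S ≤ κ) :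
    weight X ≤ κ := by
  refine (weight_le_of_isTopologicalBasis (isTopologicalBasis_of_subbasis hS)).trans ?_
  refine mk_image_le.trans ?_
  let g : Finset S → Set (Set X) := fun F => Subtype.val '' (F : Set S)
  have hsub : {f : Set (Set X) | f.Finite ∧ f ⊆ S} ⊆ range g := by
    rintro f ⟨hf, hfS⟩
    have hfin : (Subtype.val ⁻¹' f : Set S).Finite := hf.preimage Subtype.val_injective.injOn
    refine ⟨hfin.toFinset, ?_⟩
    simp only [g, Finite.coe_toFinset, Subtype.image_preimage_coe]
    exact inter_eq_right.2 hfS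
  refine (mk_le_mk_of_subset hsub).trans (mk_range_le.trans ?_)
  rcases finite_or_infinite S with h | h
  · exact (mk_lt_aleph0 (α := Finset S)).le.trans hκ
  · rw [mk_finset_of_infinite]
    exact hSc

/-- The topology generated by `S` is Hausdorff and coarser than a compact one, so the two agree and
`S` is a subbase. -/
theorem weight_le_of_separating {X : Type u} [t : TopologicalSpace X] [CompactSpace X]
    {κ : Cardinal.{u}} (hκ : ℵ₀ ≤ κ)
    {S : Set (Set X)} (hSo : ∀ U ∈ S, IsOpen U) (hSc : #S ≤ κ)
    (hS : ∀ x y : X, x ≠ y → ∃ U ∈ S, ∃ V ∈ S, x ∈ U ∧ y ∈ V ∧ Disjoint U V) :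
    weight X ≤ κ := by
  refine weight_le_of_eq_generateFrom hκ (S := S) ?_ hSc
  have hle : t ≤ generateFrom S := le_generateFrom hSo
  have hT2 : @T2Space X (generateFrom S) := by
    refine @T2Space.mk X (generateFrom S) fun x y hxy => ?_
    obtain ⟨U, hU, V, hV, hx, hy, hd⟩ := hS x y hxy
    exact ⟨U, V, isOpen_generateFrom_of_mem hU, isOpen_generateFrom_of_mem hV, hx, hy, hd⟩
  refine le_antisymm hle ?_
  have hcont : @Continuous X X t (generateFrom S) id := continuous_id_iff_le.2 hle
  have hclosed : @IsClosedMap X X t (generateFrom S) id :=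
    @Continuous.isClosedMap X X t (generateFrom S) _ hT2 id hcont
  intro U hU
  have := hclosed Uᶜ (@IsOpen.isClosed_compl X t U hU)
  rw [image_id] at this
  rwa [@isClosed_compl_iff X (generateFrom S)] at this

/-- Preimages of basic sets already separate points. This supplies the weight bounds for squares,
collapses, bouquets and cubes. -/
theorem weight_le_of_jointly_injective [CompactSpace X] {κ : Cardinal.{u}} (hκ : ℵ₀ ≤ κ)
    {ι : Type u} (hι : #ι ≤ κ) {Z : ι → Type u} [∀ i, TopologicalSpace (Z i)]
    [∀ i, T2Space (Z i)] (hZ : ∀ i, weight (Z i) ≤ κ) (f : ∀ i, X → Z i)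
    (hf : ∀ i, Continuous (f i)) (hinj : ∀ x y, (∀ i, f i x = f i y) → x = y) :
    weight X ≤ κ := by
  choose B hB hBc using fun i => exists_basis_card_eq_weight (Z i)
  refine weight_le_of_separating hκ (S := ⋃ i, (fun U => f i ⁻¹' U) '' B i) ?_ ?_ ?_
  · intro U hU
    obtain ⟨i, V, hV, rfl⟩ := mem_iUnion.1 hU
    exact ((hB i).isOpen hV).preimage (hf i)
  · refine (mk_iUnion_le _).trans ((mul_le_mul' hι (ciSup_le' fun i => ?_)).trans
      (mul_eq_self hκ).le)
    exact mk_image_le.trans ((hBc i).le.trans (hZ i))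
  · intro x y hxy
    obtain ⟨i, hi⟩ : ∃ i, f i x ≠ f i y := by
      by_contra! h
      exact hxy (hinj x y h)
    obtain ⟨U, V, hU, hV, hxU, hyV, hd⟩ := t2_separation hi
    obtain ⟨U', hU', hxU', hUU'⟩ := (hB i).exists_subset_of_mem_open hxU hU
    obtain ⟨V', hV', hyV', hVV'⟩ := (hB i).exists_subset_of_mem_open hyV hV
    exact ⟨_, mem_iUnion.2 ⟨i, U', hU', rfl⟩, _, mem_iUnion.2 ⟨i, V', hV', rfl⟩, hxU', hyV',
      (hd.mono hUU' hVV').preimage _⟩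

theorem weight_le_of_card_le [CompactSpace X] [T2Space X] {κ : Cardinal.{u}} (hκ : ℵ₀ ≤ κ)
    (hX : #X ≤ κ) : weight X ≤ κ := by
  have h : ∀ p : X × X, ∃ U V : Set X, IsOpen U ∧ IsOpen V ∧
      (p.1 ≠ p.2 → p.1 ∈ U ∧ p.2 ∈ V ∧ Disjoint U V) := by
    rintro ⟨x, y⟩
    by_cases hxy : x = y
    · exact ⟨∅, ∅, isOpen_empty, isOpen_empty, fun h => absurd hxy h⟩
    · obtain ⟨U, V, hU, hV, h1, h2, h3⟩ := t2_separation hxy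
      exact ⟨U, V, hU, hV, fun _ => ⟨h1, h2, h3⟩⟩
  choose U V hU hV hUV using h
  have hXX : #(X × X) ≤ κ := by
    rw [← mul_def]
    exact (mul_le_mul' hX hX).trans (mul_eq_self hκ).le
  refine weight_le_of_separating hκ (S := range U ∪ range V) ?_ ?_ ?_
  · rintro _ (⟨p, rfl⟩ | ⟨p, rfl⟩)
    exacts [hU p, hV p]
  · refine (mk_union_le _ _).trans ?_
    exact (add_le_add (mk_range_le.trans hXX) (mk_range_le.trans hXX)).trans (add_eq_self hκ).le
  · intro x y hxy
    obtain ⟨h1, h2, h3⟩ := hUV (x, y) hxy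
    exact ⟨_, Or.inl ⟨_, rfl⟩, _, Or.inr ⟨_, rfl⟩, h1, h2, h3⟩

theorem weight_le_card [CompactSpace X] [T2Space X] [Infinite X] : weight X ≤ #X :=
  weight_le_of_card_le (aleph0_le_mk X) le_rfl

/-- A space containing a relatively discrete family of points has weight at least the size of the
family. -/
theorem card_le_weight {ι : Type u} (x : ι → X) (U : ι → Set X) (hU : ∀ i, IsOpen (U i))
    (hmem : ∀ i j, x j ∈ U i ↔ i = j) : #ι ≤ weight X := by
  obtain ⟨B, hB, hBc⟩ := exists_basis_card_eq_weight X
  have h := fun i => hB.exists_subset_of_mem_open ((hmem i i).2 rfl) (hU i)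
  choose b hbB hxb hbU using h
  rw [← hBc]
  refine mk_le_of_injective (f := fun i => (⟨b i, hbB i⟩ : B)) fun i j hij => ?_
  have hb : b i = b j := congrArg Subtype.val hij
  exact (hmem i j).1 (hbU i (hb ▸ hxb j))

/-- A space each of whose points lies in an embedded copy of a balanced space of the same size and
weight is balanced. -/
theorem Balanced.of_embeddings (hJ : Balanced X) (hc : #Y = #X) (hw : weight Y = weight X)
    (h : ∀ y : Y, ∃ f : X → Y, IsEmbedding f ∧ y ∈ range f) : Balanced Y := by
  have key : ∀ U : Set Y, IsOpen U → U.Nonempty → #X ≤ #U ∧ weight X ≤ weight U := by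
    rintro U hU ⟨y, hy⟩
    obtain ⟨f, hf, x, rfl⟩ := h y
    have hV : IsOpen (f ⁻¹' U) := hU.preimage hf.continuous
    have hne : (f ⁻¹' U).Nonempty := ⟨x, hy⟩
    rw [← hJ.size_eq _ hV hne, ← hJ.weight_eq _ hV hne]
    exact ⟨mk_le_of_injective (hf.injective.restrictPreimage U),
      weight_le_of_isInducing (hf.restrictPreimage U).isInducing⟩
  refine ⟨?_, fun U hU hne => ?_, fun U hU hne => ?_⟩
  · have := hJ.infinite
    rw [infinite_iff, hc]
    exact aleph0_le_mk X
  · exact le_antisymm (mk_set_le U) (hc ▸ (key U hU hne).1)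
  · exact le_antisymm (weight_le_of_isInducing IsInducing.subtypeVal) (hw ▸ (key U hU hne).2)

theorem IsContinuum.infinite (h : IsContinuum X) : Infinite X := by
  have := h.hausdorff
  have := h.connected
  have := h.nontrivial
  exact infinite_univ_iff.1 (isPreconnected_univ.infinite_of_nontrivial nontrivial_univ)

end Weight

-- Cantor–Bendixson derivatives of ordinals

section CantorBendixson

universe v w w'

/-- The `o`-th Cantor–Bendixson derivative of a space. -/
def cbDerivative (X : Type w) [TopologicalSpace X] (o : Ordinal.{v}) : Set X :=
  {x | ∀ b, ∀ _ : b < o, AccPt x (Filter.principal (cbDerivative X b))}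
termination_by o

theorem mem_cbDerivative {X : Type w} [TopologicalSpace X] {o : Ordinal.{v}} {x : X} :
    x ∈ cbDerivative X o ↔ ∀ b < o, AccPt x (Filter.principal (cbDerivative X b)) := by
  rw [cbDerivative, mem_ofPred_eq]

/-- Accumulation is local. This gives homeomorphism invariance and lets derivatives of initial
segments be computed in `Ordinal`. -/
theorem preimage_cbDerivative {X : Type w} {Y : Type w'} [TopologicalSpace X] [TopologicalSpace Y]
    {f : X → Y} (hf : IsOpenEmbedding f) (o : Ordinal.{v}) :
    f ⁻¹' cbDerivative Y o = cbDerivative X o := by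
  induction o using WellFoundedLT.induction with
  | ind o ih =>
    ext x
    rw [mem_preimage, mem_cbDerivative, mem_cbDerivative]
    refine forall₂_congr fun b hb => ?_
    rw [← ih b hb, accPt_iff_nhds, accPt_iff_nhds]
    constructor
    · intro h U hU
      obtain ⟨_, ⟨⟨y, hy, rfl⟩, hyD⟩, hne⟩ := h (f '' U) (hf.image_mem_nhds.2 hU)
      exact ⟨y, ⟨hy, hyD⟩, fun h => hne (h ▸ rfl)⟩
    · intro h U hU
      obtain ⟨y, ⟨hy, hyD⟩, hne⟩ := h (f ⁻¹' U) (hf.continuous.continuousAt hU)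
      exact ⟨f y, ⟨hy, hyD⟩, fun h => hne (hf.injective h)⟩

open Ordinal

theorem mem_cbDerivative_of_dvd (b : Ordinal.{v}) {x : Ordinal.{v}} (hx : x ≠ 0)
    (hd : ω ^ b ∣ x) : x ∈ cbDerivative Ordinal.{v} b := by
  induction b using WellFoundedLT.induction generalizing x with
  | ind b ih =>
    rw [mem_cbDerivative]
    intro c hc
    rw [SuccOrder.accPt_principal]
    refine ⟨fun h => hx (h.eq_bot), fun y hy => ?_⟩
    have hc0 : ω ^ c ≠ 0 := opow_ne_zero _ omega0_ne_zero
    obtain ⟨m, rfl⟩ : ω ^ (c + 1) ∣ x :=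
      (opow_dvd_opow _ (Order.add_one_le_of_lt hc)).trans hd
    have hm : m ≠ 0 := by
      rintro rfl
      simp at hx
    rw [opow_add, opow_one, mul_assoc] at hy ⊢
    have hlim : Order.IsSuccLimit (ω * m) :=
      isSuccLimit_mul_left isSuccLimit_omega0 (pos_iff_ne_zero.2 hm)
    -- The witness is the first multiple of `ω ^ c` above `y`; it stays below `x` because `ω * m` is
    -- a limit.
    refine ⟨ω ^ c * Order.succ (y / ω ^ c), ih c hc ?_ (dvd_mul_right _ _),
      lt_mul_succ_div y hc0, ?_⟩
    · exact mul_ne_zero hc0 (Order.succ_ne_bot _)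
    · refine (mul_lt_mul_iff_right₀ (pos_iff_ne_zero.2 hc0)).2 (hlim.succ_lt ?_)
      exact (lt_mul_iff_div_lt hc0).1 hy

/-- A limit of multiples of `ω ^ c` is `ω ^ c` times a limit ordinal, hence a multiple of `ω ^ (c +
1)`. -/
theorem dvd_of_mem_cbDerivative (b : Ordinal.{v}) {x : Ordinal.{v}}
    (hx : x ∈ cbDerivative Ordinal.{v} b) : ω ^ b ∣ x := by
  induction b using WellFoundedLT.induction generalizing x with
  | ind b ih =>
    rw [mem_cbDerivative] at hx
    have hne : ∀ c < b, ∀ y < x, ∃ z, ω ^ c ∣ z ∧ y < z ∧ z < x := by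
      intro c hc y hy
      obtain ⟨z, hz, hz'⟩ := (SuccOrder.accPt_principal.1 (hx c hc)).2 y hy
      exact ⟨z, ih c hc hz, hz'⟩
    have hd : ∀ c < b, ω ^ (c + 1) ∣ x := by
      intro c hc
      have hc0 : ω ^ c ≠ 0 := opow_ne_zero _ omega0_ne_zero
      have hb0 : ω ^ (c + 1) ≠ 0 := opow_ne_zero _ omega0_ne_zero
      have hmul : ∀ q, ω ^ c * q < x → ω ^ c * Order.succ q < x := by
        intro q hq
        obtain ⟨_, ⟨m, rfl⟩, h1, h2⟩ := hne c hc _ hq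
        rw [mul_lt_mul_iff_right₀ (pos_iff_ne_zero.2 hc0)] at h1
        exact (mul_le_mul_right (Order.succ_le_of_lt h1) _).trans_lt h2
      -- Otherwise `hmul` would put the next multiple of `ω ^ c` below `x`, against the definition
      -- of the quotient.
      have hle : ω ^ c * (x / ω ^ c) = x := by
        refine (mul_div_le x _).antisymm (le_of_not_gt fun h => ?_)
        exact (hmul _ h).not_ge (lt_mul_succ_div x hc0).le
      rw [opow_add, opow_one, ← hle]
      refine mul_dvd_mul_left _ ?_
      rw [← isSuccPrelimit_iff_omega0_dvd]
      refine Order.isSuccPrelimit_of_succ_lt fun m hm => ?_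
      have := hmul m (hle ▸ (mul_lt_mul_iff_right₀ (pos_iff_ne_zero.2 hc0)).2 hm)
      rw [← hle] at this
      exact (mul_lt_mul_iff_right₀ (pos_iff_ne_zero.2 hc0)).1 this
    rcases zero_or_succ_or_isSuccLimit b with rfl | ⟨c, rfl⟩ | hb
    · simp
    · exact hd c (Order.lt_succ c)
    · have hb0 : ω ^ b ≠ 0 := opow_ne_zero _ omega0_ne_zero
      refine dvd_of_mod_eq_zero ?_
      by_contra hr
      -- For limit `b`, the remainder modulo `ω ^ b` is below some `ω ^ c` and yet divisible by it,
      -- so it vanishes.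
      obtain ⟨c, hc, hlt⟩ := (lt_opow_of_isSuccLimit omega0_ne_zero hb).1 (mod_lt x hb0)
      have h1 : ω ^ c ∣ x := (opow_dvd_opow _ (Order.le_succ c)).trans (hd c hc)
      have h2 : ω ^ c ∣ ω ^ b * (x / ω ^ b) := (opow_dvd_opow _ hc.le).trans (dvd_mul_right _ _)
      rw [← div_add_mod x (ω ^ b), Ordinal.dvd_add_iff h2] at h1
      exact hlt.not_ge (le_of_dvd hr h1)

theorem isOpen_Iic_ordinal (a : Ordinal.{v}) : IsOpen (Iic a) := by
  rw [← Order.Iio_succ]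
  exact isOpen_Iio

theorem opow_mem_cbDerivative_Iic (a : Ordinal.{v}) :
    (⟨ω ^ a, self_mem_Iic⟩ : Iic (ω ^ a)) ∈ cbDerivative (Iic (ω ^ a)) a := by
  rw [← preimage_cbDerivative (isOpen_Iic_ordinal _).isOpenEmbedding_subtypeVal]
  exact mem_cbDerivative_of_dvd a (opow_ne_zero _ omega0_ne_zero) dvd_rfl

theorem cbDerivative_Iic_eq_empty {a b : Ordinal.{v}} (h : a < b) :
    cbDerivative (Iic (ω ^ a)) b = ∅ := by
  rw [← preimage_cbDerivative (isOpen_Iic_ordinal _).isOpenEmbedding_subtypeVal,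
    eq_empty_iff_forall_notMem]
  rintro ⟨x, hx⟩ hmem
  rw [mem_preimage] at hmem
  have hd := dvd_of_mem_cbDerivative b hmem
  rcases eq_or_ne x 0 with rfl | hx0
  · exact (SuccOrder.accPt_principal.1 (mem_cbDerivative.1 hmem a h)).1 isMin_bot
  · exact (le_of_dvd hx0 hd).not_gt
      (lt_of_le_of_lt hx ((opow_lt_opow_iff_right one_lt_omega0).2 h))

/-- The exponent is the last index at which the derivative is nonempty. -/
theorem eq_of_homeomorph_Iic_opow {a b : Ordinal.{v}} (h : Iic (ω ^ a) ≃ₜ Iic (ω ^ b)) :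
    a = b := by
  have key : ∀ {a b : Ordinal.{v}}, (Iic (ω ^ a) ≃ₜ Iic (ω ^ b)) → ¬ b < a := by
    intro a b h hlt
    have := opow_mem_cbDerivative_Iic a
    rw [← preimage_cbDerivative h.isOpenEmbedding, cbDerivative_Iic_eq_empty hlt] at this
    exact this
  exact le_antisymm (le_of_not_gt (key h)) (le_of_not_gt (key h.symm))

instance totallyDisconnectedSpace_ordinal : TotallyDisconnectedSpace Ordinal.{v} := by
  suffices TotallySeparatedSpace Ordinal.{v} from inferInstance
  refine totallySeparatedSpace_iff_exists_isClopen.2 fun x y hxy => ?_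
  rcases lt_or_gt_of_ne hxy with h | h
  · exact ⟨Iic x, ⟨isClosed_Iic, isOpen_Iic_ordinal x⟩, self_mem_Iic,
      fun h' => h.not_ge (mem_Iic.1 h')⟩
  · exact ⟨Ioi y, ⟨by rw [← compl_Iic]; exact (isOpen_Iic_ordinal y).isClosed_compl, isOpen_Ioi⟩,
      h, fun h' => lt_irrefl y (mem_Ioi.1 h')⟩

/-- There are `κ` mutually non-homeomorphic totally disconnected compact Hausdorff spaces with at
least two and at most `κ` points. -/
theorem exists_nonhomeomorphic_totallyDisconnected {κ : Cardinal.{u}} (hκ : ℵ₀ ≤ κ) (ι : Type u)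
    (hι : #ι ≤ κ) :
    ∃ (Z : ι → Type u) (_ : ∀ i, TopologicalSpace (Z i)),
      (∀ i, CompactSpace (Z i) ∧ T2Space (Z i) ∧ TotallyDisconnectedSpace (Z i) ∧
        Nontrivial (Z i) ∧ #(Z i) ≤ κ) ∧
      ∀ i j, Nonempty (Z i ≃ₜ Z j) → i = j := by
  let r : ι → ι → Prop := WellOrderingRel
  let e : ι → Ordinal.{u} := fun i => typein r i
  have he : Function.Injective e := typein_injective r
  have hcard : ∀ i, (ω ^ e i).card ≤ κ := fun i => by
    refine (card_opow_le _ _).trans (max_le hκ (max_le (by simpa using hκ) ?_))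
    refine le_trans ?_ hι
    have := card_le_card (typein_lt_type r i).le
    rwa [card_type] at this
  -- Segments of `Ordinal.{u}` live one universe too high, hence `Shrink`.
  refine ⟨fun i => Shrink.{u} (Iic (ω ^ e i)), fun i => inferInstance, fun i => ?_, ?_⟩
  · let h := Shrink.homeomorph.{u} (Iic (ω ^ e i))
    have hc : CompactSpace (Iic (ω ^ e i)) := by
      rw [← isCompact_iff_compactSpace, ← Icc_bot]
      exact isCompact_Icc
    refine ⟨h.compactSpace, h.t2Space, ?_, ?_, ?_⟩
    · exact h.totallyDisconnectedSpace
    · have : Nontrivial (Iic (ω ^ e i)) :=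
        ⟨⟨0, mem_Iic.2 bot_le⟩, ⟨ω ^ e i, self_mem_Iic⟩, fun h =>
          opow_ne_zero (e i) omega0_ne_zero (congrArg Subtype.val h).symm⟩
      exact h.toEquiv.symm.nontrivial
    · rw [← Cardinal.lift_le.{u + 1}, Cardinal.lift_mk_shrink'', ← Order.Iio_succ,
        Cardinal.mk_Iio_ordinal, Order.succ_eq_add_one, Cardinal.lift_le, card_add_one]
      exact (add_le_add (hcard i) (one_le_aleph0.trans hκ)).trans (add_eq_self hκ).le
  · rintro i j ⟨h⟩
    exact he (eq_of_homeomorph_Iic_opow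
      ((Shrink.homeomorph _).trans (h.trans (Shrink.homeomorph _).symm)))

end CantorBendixson

-- Punctured squares and collapsed products

/-- The complement of a point in the square of a nontrivial connected space is connected. -/
theorem isPreconnected_compl_singleton_prod {J : Type u} [TopologicalSpace J] [ConnectedSpace J]
    [Nontrivial J] (p : J × J) : IsPreconnected ({p}ᶜ : Set (J × J)) := by
  obtain ⟨a, b⟩ := p
  obtain ⟨x, hx⟩ := exists_ne a
  obtain ⟨y, hy⟩ := exists_ne b
  have hv : ∀ x : J, IsPreconnected (({x} : Set J) ×ˢ (Set.univ : Set J)) := fun x =>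
    isPreconnected_singleton.prod isPreconnected_univ
  have hh : ∀ y : J, IsPreconnected ((Set.univ : Set J) ×ˢ ({y} : Set J)) := fun y =>
    isPreconnected_univ.prod isPreconnected_singleton
  have hcross : ∀ x y : J, IsPreconnected (({x} : Set J) ×ˢ (Set.univ : Set J) ∪ Set.univ ×ˢ {y}) :=
    fun x y => IsPreconnected.union (x, y) (by simp) (by simp) (hv x) (hh y)
  refine isPreconnected_of_forall (x, y) fun q hq => ?_
  obtain ⟨c, d⟩ := q
  by_cases hc : c = a
  · have hd : d ≠ b := fun h => hq (by simp [hc, h])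
    refine ⟨_, ?_, ?_, ?_, hcross x d⟩
    · rintro ⟨s, t⟩ h
      simp only [mem_union, mem_prod, mem_singleton_iff, mem_univ, and_true, true_and] at h
      simp only [mem_compl_iff, mem_singleton_iff, Prod.mk.injEq]
      rintro ⟨rfl, rfl⟩
      exact h.elim (fun h => hx h.symm) (fun h => hd h.symm)
    · simp
    · simp
  · refine ⟨_, ?_, ?_, ?_, hcross c y⟩
    · rintro ⟨s, t⟩ h
      simp only [mem_union, mem_prod, mem_singleton_iff, mem_univ, and_true, true_and] at h
      simp only [mem_compl_iff, mem_singleton_iff, Prod.mk.injEq]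
      rintro ⟨rfl, rfl⟩
      exact h.elim (fun h => hc h.symm) (fun h => hy h.symm)
    · simp
    · simp

section Collapse

variable {Z P : Type u} [TopologicalSpace Z] [TopologicalSpace P]

/-- A realisation of the space obtained from `Z × P` by collapsing `Z × {p}` to the point `c`. -/
structure IsCollapse {Y : Type u} [TopologicalSpace Y] (p : P) (c : Y) (j : Z → P → Y)
    (π : Y → Z) : Prop where
  compact : CompactSpace Y
  hausdorff : T2Space Y
  continuous : ∀ z, Continuous (j z)
  continuous_left : ∀ x, Continuous fun z => j z x
  injective : ∀ z, Function.Injective (j z)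
  surjective : ∀ y, ∃ z x, j z x = y
  base : ∀ z, j z p = c
  proj : ∀ z x, x ≠ p → π (j z x) = z
  continuousOn : ContinuousOn π {c}ᶜ

/-- The collapse is realised as the image of a map into a power of `P` instead of as a quotient, so
that the Hausdorff property and the weight bound come from the power. -/
theorem exists_isCollapse [CompactSpace Z] [T2Space Z] [TotallyDisconnectedSpace Z] [Nonempty Z]
    [CompactSpace P] [T2Space P] {κ : Cardinal.{u}} (hκ : ℵ₀ ≤ κ) (hZ : #Z ≤ κ)
    (hP : weight P ≤ κ) (p : P) :
    ∃ (Y : Type u) (_ : TopologicalSpace Y) (c : Y) (j : Z → P → Y) (π : Y → Z),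
      IsCollapse p c j π ∧ weight Y ≤ κ := by
  classical
  have hsep : ∀ q : Z × Z, ∃ V : Set Z, IsClopen V ∧ (q.1 ≠ q.2 → q.1 ∈ V ∧ q.2 ∉ V) := by
    rintro ⟨z, z'⟩
    by_cases h : z = z'
    · exact ⟨∅, isClopen_empty, fun h' => absurd h h'⟩
    · obtain ⟨V, hV, h1, h2⟩ := exists_isClopen_of_totally_separated h
      exact ⟨V, hV, fun _ => ⟨h1, h2⟩⟩
  choose V hV hVsep using hsep
  let W : Option (Z × Z) → Set Z := fun i => i.elim Set.univ V
  have hW : ∀ i, IsClopen (W i) := by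
    rintro (_ | q)
    exacts [isClopen_univ, hV q]
  -- Coordinate `none` records the `P`-component; the clopen coordinates record the `Z`-component
  -- exactly when the former is not `p`.
  let Φ : Z × P → Option (Z × Z) → P := fun w i => if w.1 ∈ W i then w.2 else p
  have hΦ : Continuous Φ := by
    refine continuous_pi fun i => Continuous.if (fun w hw => ?_) (by fun_prop) (by fun_prop)
    have : IsClopen {w : Z × P | w.1 ∈ W i} := (hW i).preimage continuous_fst
    rw [this.frontier_eq] at hw
    exact hw.elim
  have hΦeq : ∀ z x z' x', Φ (z, x) = Φ (z', x') ↔ (x = x' ∧ (x ≠ p → z = z')) := by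
    intro z x z' x'
    constructor
    · intro h
      have hx : x = x' := by simpa [Φ, W] using congrFun h none
      subst hx
      refine ⟨rfl, fun hxp => ?_⟩
      by_contra hzz
      obtain ⟨h1, h2⟩ := hVsep (z, z') hzz
      have := congrFun h (some (z, z'))
      simp only [Φ, W, Option.elim_some, h1, h2, if_true, if_false] at this
      exact hxp this
    · rintro ⟨rfl, h⟩
      by_cases hxp : x = p
      · funext i
        simp [Φ, hxp]
      · rw [h hxp]
  let g : Z × P → range Φ := rangeFactorization Φ
  have hg : Continuous g := hΦ.rangeFactorization
  have hgsurj : Function.Surjective g := rangeFactorization_surjective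
  have hgeq : ∀ z x z' x', g (z, x) = g (z', x') ↔ (x = x' ∧ (x ≠ p → z = z')) := by
    intro z x z' x'
    rw [← hΦeq]
    exact Subtype.ext_iff
  have hcomp : CompactSpace (range Φ) := isCompact_iff_compactSpace.1 (isCompact_range hΦ)
  obtain ⟨z₀⟩ := ‹Nonempty Z›
  -- The value at the apex is arbitrary; continuity is claimed only away from it.
  let π : range Φ → Z := fun y => (Function.surjInv hgsurj y).1
  have hπ : ∀ z x, x ≠ p → π (g (z, x)) = z := by
    intro z x hx
    have h := (hgeq _ _ _ _).1 (Function.surjInv_eq hgsurj (g (z, x))).symm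
    exact (h.2 hx).symm
  have hbase : ∀ z x, g (z, x) = g (z₀, p) ↔ x = p := fun z x => by
    rw [hgeq]
    exact ⟨fun h => h.1, fun h => ⟨h, fun h' => absurd h h'⟩⟩
  refine ⟨range Φ, inferInstance, g (z₀, p), fun z x => g (z, x), π, ⟨hcomp, inferInstance,
    fun z => hg.comp (by fun_prop), fun x => hg.comp (by fun_prop), ?_, ?_, ?_, hπ, ?_⟩, ?_⟩
  · intro z x x' h
    exact ((hgeq _ _ _ _).1 h).1
  · intro y
    obtain ⟨⟨z, x⟩, h⟩ := hgsurj y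
    exact ⟨z, x, h⟩
  · exact fun z => (hbase z p).2 rfl
  · have hq : IsQuotientMap (({g (z₀, p)}ᶜ : Set (range Φ)).restrictPreimage g) :=
      (hg.isClosedMap.isQuotientMap hg hgsurj).restrictPreimage_isOpen isOpen_compl_singleton
    rw [continuousOn_iff_continuous_domRestrict, hq.continuous_iff]
    have : ({g (z₀, p)}ᶜ : Set (range Φ)).domRestrict π ∘
        ({g (z₀, p)}ᶜ : Set (range Φ)).restrictPreimage g = fun w => w.1.1 := by
      funext ⟨⟨z, x⟩, hw⟩
      exact hπ z x fun h => hw ((hbase z x).2 h)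
    rw [this]
    fun_prop
  · refine weight_le_of_jointly_injective hκ (ι := Option (Z × Z)) (Z := fun _ => P) ?_
      (fun _ => hP) (fun i y => y.1 i) (fun i => (continuous_apply i).comp continuous_subtype_val)
      fun x y h => Subtype.ext (funext h)
    rw [mk_option, ← mul_def]
    exact (add_le_add ((mul_le_mul' hZ hZ).trans (mul_eq_self hκ).le)
      (one_le_aleph0.trans hκ)).trans (add_eq_self hκ).le

namespace IsCollapse

variable {Y : Type u} [TopologicalSpace Y] {p : P} {c : Y} {j : Z → P → Y} {π : Y → Z}

theorem eq_base_iff (h : IsCollapse p c j π) (z : Z) (x : P) : j z x = c ↔ x = p := by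
  rw [← h.base z]
  exact (h.injective z).eq_iff

theorem joined [PathConnectedSpace P] (h : IsCollapse p c j π) (y : Y) : Joined c y := by
  obtain ⟨z, x, rfl⟩ := h.surjective y
  rw [← h.base z]
  exact (PathConnectedSpace.joined p x).map (h.continuous z)

theorem pathConnectedSpace [PathConnectedSpace P] (h : IsCollapse p c j π) :
    PathConnectedSpace Y where
  nonempty := ⟨c⟩
  joined x y := (h.joined x).symm.trans (h.joined y)

theorem preimage_eq (h : IsCollapse p c j π) (z : Z) :
    {c}ᶜ ∩ π ⁻¹' {z} = j z '' {p}ᶜ := by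
  ext y
  constructor
  · rintro ⟨hy, hz⟩
    obtain ⟨z', x, rfl⟩ := h.surjective y
    have hx : x ≠ p := fun hx => hy ((h.eq_base_iff _ _).2 hx)
    rw [mem_preimage, h.proj _ _ hx, mem_singleton_iff] at hz
    exact ⟨x, hx, by rw [hz]⟩
  · rintro ⟨x, hx, rfl⟩
    exact ⟨fun hy => hx ((h.eq_base_iff _ _).1 hy), h.proj _ _ hx⟩

/-- Each blade loses at most one point, stays connected, and still contains the apex. -/
theorem isPreconnected_compl_singleton [PreconnectedSpace P]
    (hP : ∀ x : P, IsPreconnected ({x}ᶜ : Set P)) (h : IsCollapse p c j π) {y : Y} (hy : y ≠ c) :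
    IsPreconnected ({y}ᶜ : Set Y) := by
  refine isPreconnected_of_forall c fun w hw => ?_
  obtain ⟨z, x, rfl⟩ := h.surjective w
  have himg : IsPreconnected (j z ⁻¹' {y}ᶜ) := by
    by_cases hex : ∃ x₀, j z x₀ = y
    · obtain ⟨x₀, rfl⟩ := hex
      rw [preimage_compl, ← image_singleton, preimage_image_eq _ (h.injective z)]
      exact hP x₀
    · rw [eq_univ_of_forall (s := j z ⁻¹' {y}ᶜ) fun x hx => hex ⟨x, hx⟩]
      exact isPreconnected_univ
  refine ⟨j z '' (j z ⁻¹' {y}ᶜ), image_preimage_subset _ _, ⟨p, ?_, h.base z⟩, ⟨x, hw, rfl⟩,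
    himg.image _ (h.continuous z).continuousOn⟩
  rw [mem_preimage, h.base z]
  exact hy.symm

end IsCollapse

end Collapse

-- Compact bouquets

section Bouquet

/-- The compact bouquet of pointed spaces: the points of the product with at most one coordinate
different from the base point. -/
def Bouquet {ι : Type u} {Y : ι → Type u} (e : ∀ i, Y i) : Type u :=
  {f : ∀ i, Y i // ∀ i k, i ≠ k → f i = e i ∨ f k = e k}

namespace Bouquet

variable {ι : Type u} {Y : ι → Type u} {e : ∀ i, Y i}

/-- The base point of a bouquet. -/
def base (e : ∀ i, Y i) : Bouquet e := ⟨e, fun _ _ _ => Or.inl rfl⟩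

/-- The coordinate projections of a bouquet. -/
def proj (i : ι) (f : Bouquet e) : Y i := f.1 i

open Classical in
/-- The inclusion of a summand into a bouquet. -/
noncomputable def incl (e : ∀ i, Y i) (i : ι) (y : Y i) : Bouquet e :=
  ⟨Function.update e i y, fun k l hkl => by
    by_cases hk : k = i
    · exact Or.inr (Function.update_of_ne (fun hl => hkl (hk.trans hl.symm)) _ _)
    · exact Or.inl (Function.update_of_ne hk _ _)⟩

@[simp]
theorem proj_incl_same (i : ι) (y : Y i) : proj i (incl e i y) = y := by
  simp [proj, incl]

theorem proj_incl_of_ne {i k : ι} (h : k ≠ i) (y : Y i) : proj k (incl e i y) = e k := by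
  classical
  exact Function.update_of_ne h _ _

theorem ext {f g : Bouquet e} (h : ∀ i, proj i f = proj i g) : f = g :=
  Subtype.ext (funext h)

@[simp]
theorem proj_base (i : ι) : proj i (base e) = e i := rfl

@[simp]
theorem incl_base (i : ι) : incl e i (e i) = base e := by
  refine ext fun k => ?_
  by_cases h : k = i
  · subst h
    simp
  · rw [proj_incl_of_ne h, proj_base]

theorem incl_proj_of_ne {f : Bouquet e} {i : ι} (h : proj i f ≠ e i) : incl e i (proj i f) = f := by
  refine ext fun k => ?_
  by_cases hk : k = i
  · subst hk
    simp
  · rw [proj_incl_of_ne hk]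
    exact ((f.2 k i hk).resolve_right h).symm

theorem exists_proj_ne {f : Bouquet e} (h : f ≠ base e) : ∃ i, proj i f ≠ e i := by
  by_contra! hf
  exact h (ext hf)

theorem exists_incl [Nonempty ι] (f : Bouquet e) : ∃ i y, incl e i y = f := by
  by_cases h : f = base e
  · exact ⟨Classical.arbitrary ι, e _, by rw [h, incl_base]⟩
  · obtain ⟨i, hi⟩ := exists_proj_ne h
    exact ⟨i, _, incl_proj_of_ne hi⟩

variable [∀ i, TopologicalSpace (Y i)]

instance : TopologicalSpace (Bouquet e) :=
  inferInstanceAs (TopologicalSpace {f : ∀ i, Y i // ∀ i k, i ≠ k → f i = e i ∨ f k = e k})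

instance [∀ i, T2Space (Y i)] : T2Space (Bouquet e) :=
  inferInstanceAs (T2Space {f : ∀ i, Y i // ∀ i k, i ≠ k → f i = e i ∨ f k = e k})

theorem continuous_proj (i : ι) : Continuous (proj (e := e) i) :=
  (continuous_apply i).comp continuous_subtype_val

theorem continuous_incl (i : ι) : Continuous (incl e i) := by
  classical
  exact (continuous_const.update i continuous_id).subtype_mk _

theorem compactSpace [∀ i, CompactSpace (Y i)] [∀ i, T2Space (Y i)] :
    CompactSpace (Bouquet e) := by
  have hcl : IsClosedEmbedding (Subtype.val : Bouquet e → ∀ i, Y i) := by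
    refine ⟨IsEmbedding.subtypeVal, ?_⟩
    rw [show range (Subtype.val : Bouquet e → ∀ i, Y i) =
      {f | ∀ i k, i ≠ k → f i = e i ∨ f k = e k} from Subtype.range_coe_subtype]
    have : {f : ∀ i, Y i | ∀ i k, i ≠ k → f i = e i ∨ f k = e k} =
        ⋂ i, ⋂ k, ⋂ _ : i ≠ k, {f | f i = e i} ∪ {f | f k = e k} := by
      ext f
      simp
    rw [this]
    exact isClosed_iInter fun i => isClosed_iInter fun k => isClosed_iInter fun _ =>
      (isClosed_eq (continuous_apply i) continuous_const).union
        (isClosed_eq (continuous_apply k) continuous_const)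
  exact hcl.compactSpace

theorem isEmbedding_incl (i : ι) : IsEmbedding (incl e i) :=
  IsEmbedding.of_comp (continuous_incl i) (continuous_proj i) (by
    have : proj i ∘ incl e i = id := funext fun y => proj_incl_same i y
    rw [this]
    exact IsEmbedding.id)

theorem joined_base [∀ i, PathConnectedSpace (Y i)] (f : Bouquet e) : Joined (base e) f := by
  by_cases h : f = base e
  · rw [h]
  · obtain ⟨i, hi⟩ := exists_proj_ne h
    rw [← incl_proj_of_ne hi, ← incl_base i]
    exact (PathConnectedSpace.joined (e i) (proj i f)).map (continuous_incl i)

theorem pathConnectedSpace [∀ i, PathConnectedSpace (Y i)] : PathConnectedSpace (Bouquet e) where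
  nonempty := ⟨base e⟩
  joined f g := (joined_base f).symm.trans (joined_base g)

/-- The preimage of a connected set under a coordinate projection of a bouquet of connected spaces
is connected. -/
theorem isPreconnected_preimage_proj [∀ i, PreconnectedSpace (Y i)] (i : ι) {S : Set (Y i)}
    (hS : IsPreconnected S) : IsPreconnected (proj (e := e) i ⁻¹' S) := by
  have himg : IsPreconnected (incl e i '' S) := hS.image _ (continuous_incl i).continuousOn
  have hsub : incl e i '' S ⊆ proj i ⁻¹' S := by
    rintro _ ⟨y, hy, rfl⟩
    simpa using hy
  -- If `S` contains the gluing point, all other summands lie in the preimage and meet the copy of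
  -- `S` at the base; otherwise the preimage is just that copy.
  by_cases he : e i ∈ S
  · refine isPreconnected_of_forall (base e) fun f hf => ?_
    by_cases hfi : f ∈ incl e i '' S
    · exact ⟨_, hsub, ⟨e i, he, incl_base i⟩, hfi, himg⟩
    · have hfi' : proj i f = e i := by
        by_contra h
        exact hfi ⟨_, hf, incl_proj_of_ne h⟩
      have hf0 : f ≠ base e := fun h => hfi ⟨e i, he, by rw [h, incl_base]⟩
      obtain ⟨k, hk⟩ := exists_proj_ne hf0
      have hki : i ≠ k := by
        rintro rfl
        exact hk hfi'
      refine ⟨range (incl e k), ?_, ⟨e k, incl_base k⟩, ⟨_, incl_proj_of_ne hk⟩,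
        isPreconnected_range (continuous_incl k)⟩
      rintro _ ⟨y, rfl⟩
      rwa [mem_preimage, proj_incl_of_ne hki]
  · have : proj i ⁻¹' S = incl e i '' S := by
      refine Subset.antisymm (fun f hf => ?_) hsub
      exact ⟨_, hf, incl_proj_of_ne fun h => he (h ▸ hf)⟩
    rwa [this]

theorem isPreconnected_compl_singleton [∀ i, PreconnectedSpace (Y i)] (i : ι) {y : Y i}
    (hy : y ≠ e i) (h : IsPreconnected ({y}ᶜ : Set (Y i))) :
    IsPreconnected ({incl e i y}ᶜ : Set (Bouquet e)) := by
  have : ({incl e i y}ᶜ : Set (Bouquet e)) = proj i ⁻¹' {y}ᶜ := by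
    ext f
    simp only [mem_compl_iff, mem_singleton_iff, mem_preimage, not_iff_not]
    constructor
    · rintro rfl
      simp
    · rintro rfl
      exact (incl_proj_of_ne hy).symm
  rw [this]
  exact isPreconnected_preimage_proj i h

theorem weight_le [∀ i, CompactSpace (Y i)] [∀ i, T2Space (Y i)] {κ : Cardinal.{u}}
    (hκ : ℵ₀ ≤ κ) (hι : #ι ≤ κ) (hY : ∀ i, weight (Y i) ≤ κ) : weight (Bouquet e) ≤ κ := by
  have := compactSpace (e := e)
  exact weight_le_of_jointly_injective hκ hι hY (fun i => proj i) (fun i => continuous_proj i)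
    fun _ _ h => ext h

theorem card_le_weight [∀ i, T1Space (Y i)] (hY : ∀ i, ∃ y, y ≠ e i) :
    #ι ≤ weight (Bouquet e) := by
  choose y hy using hY
  refine CountingContinua.card_le_weight (fun i => incl e i (y i))
    (fun i => proj i ⁻¹' {e i}ᶜ) (fun i => isOpen_compl_singleton.preimage (continuous_proj i))
    fun i k => ?_
  rw [mem_preimage, mem_compl_iff, mem_singleton_iff]
  constructor
  · intro h
    by_contra hik
    exact h (proj_incl_of_ne hik _)
  · rintro rfl
    simpa using hy i

/-- Away from the base point, the index of the nontrivial coordinate is locally constant. -/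
theorem exists_index [Nonempty ι] [∀ i, T1Space (Y i)] :
    ∃ ν : Bouquet e → ι, (∀ i y, y ≠ e i → ν (incl e i y) = i) ∧
      ∀ i, IsOpen ({base e}ᶜ ∩ ν ⁻¹' {i}) := by
  classical
  -- The value at the base point is a dummy.
  let ν : Bouquet e → ι := fun f =>
    if h : ∃ i, proj i f ≠ e i then h.choose else Classical.arbitrary ι
  have hν : ∀ f i, proj i f ≠ e i → ν f = i := by
    intro f i hi
    have h : ∃ i, proj i f ≠ e i := ⟨i, hi⟩
    have hνf : ν f = h.choose := dif_pos h
    rw [hνf]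
    by_contra hne
    exact (f.2 _ _ hne).elim h.choose_spec hi
  refine ⟨ν, fun i y hy => hν _ _ (by simpa using hy), fun i => ?_⟩
  have : ({base e}ᶜ ∩ ν ⁻¹' {i} : Set (Bouquet e)) = proj i ⁻¹' {e i}ᶜ := by
    ext f
    constructor
    · rintro ⟨hf, rfl⟩
      obtain ⟨k, hk⟩ := exists_proj_ne hf
      have := hν f k hk
      subst this
      exact hk
    · intro hf
      exact ⟨fun h => hf (by rw [mem_singleton_iff.1 h, proj_base, mem_singleton_iff]), hν f i hf⟩
  rw [this]
  exact isOpen_compl_singleton.preimage (continuous_proj i)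

end Bouquet

end Bouquet

-- Component spaces of point complements

section ComponentSpace

/-- `Z` is the space of components of the complement of a point of `X`, witnessed by a continuous
map with connected fibres and a continuous section. -/
def IsComplComponentSpace (X Z : Type u) [TopologicalSpace X] [TopologicalSpace Z] : Prop :=
  ∃ (x : X) (f : X → Z) (s : Z → X), ContinuousOn f {x}ᶜ ∧ Continuous s ∧ (∀ z, s z ≠ x) ∧
    (∀ z, f (s z) = z) ∧ ∀ z, IsPreconnected ({x}ᶜ ∩ f ⁻¹' {z})

variable {X X' Z : Type u} [TopologicalSpace X]

theorem IsComplComponentSpace.congr [TopologicalSpace X'] [TopologicalSpace Z] (h : X ≃ₜ X')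
    (hX : IsComplComponentSpace X Z) :
    IsComplComponentSpace X' Z := by
  obtain ⟨x, f, s, hf, hs, hsx, hfs, hpre⟩ := hX
  refine ⟨h x, f ∘ h.symm, h ∘ s, ?_, h.continuous.comp hs, fun z hz => hsx z (h.injective hz),
    fun z => by simp [hfs], fun z => ?_⟩
  · refine hf.comp h.symm.continuous.continuousOn fun y hy hx => hy ?_
    rw [← mem_singleton_iff.1 hx, h.apply_symm_apply, mem_singleton_iff]
  · have : ({h x}ᶜ ∩ (f ∘ h.symm) ⁻¹' {z} : Set X') = h '' ({x}ᶜ ∩ f ⁻¹' {z}) := by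
      rw [image_inter h.injective, image_compl_eq h.bijective, image_singleton, preimage_comp,
        ← h.image_eq_preimage_symm]
    rw [this]
    exact (hpre z).image _ h.continuous.continuousOn

/-- Maps into totally disconnected spaces factor through the space of components. -/
theorem eq_of_isPreconnected_fibres {T : Type u} [TopologicalSpace T] [TotallyDisconnectedSpace T]
    {x : X} {f : X → Z} {s : Z → X} (hsx : ∀ z, s z ≠ x) (hfs : ∀ z, f (s z) = z)
    (hpre : ∀ z, IsPreconnected ({x}ᶜ ∩ f ⁻¹' {z})) {g : X → T} (hg : ContinuousOn g {x}ᶜ) {y : X}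
    (hy : y ≠ x) : g (s (f y)) = g y :=
  ((hpre (f y)).image g (hg.mono inter_subset_left)).subsingleton
    (mem_image_of_mem g ⟨hsx _, hfs _⟩) (mem_image_of_mem g ⟨hy, rfl⟩)

end ComponentSpace

-- Recovering the index set from the bouquet

section Coding

variable {ι P : Type u} {A : Set ι} {Z : ι → Type u} {Y : ι → Type u}
  [∀ i, TopologicalSpace (Z i)] [∀ i, TopologicalSpace (Y i)] [TopologicalSpace P] {p q : P}
  {c : ∀ i, Y i} {j : ∀ i, Z i → P → Y i} {π : ∀ i, Y i → Z i}

/-- The other summands hang on the `i`-th one at a point of the blade `z i`, so they only enlarge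
that component. The points `j i w q` give the section. -/
theorem isComplComponentSpace_bouquet [PathConnectedSpace P]
    (hP : ∀ x : P, IsPreconnected ({x}ᶜ : Set P)) (hqp : q ≠ p)
    (h : ∀ i, IsCollapse p (c i) (j i) (π i)) (z : ∀ i, Z i) (i : ι) :
    ∃ (f : Bouquet (fun i => j i (z i) q) → Z i) (s : Z i → Bouquet (fun i => j i (z i) q)),
      ContinuousOn f {Bouquet.incl _ i (c i)}ᶜ ∧ Continuous s ∧
      (∀ w, s w ≠ Bouquet.incl _ i (c i)) ∧ (∀ w, f (s w) = w) ∧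
      ∀ w, IsPreconnected ({Bouquet.incl _ i (c i)}ᶜ ∩ f ⁻¹' {w}) := by
  have := fun i => (h i).pathConnectedSpace
  set e : ∀ i, Y i := fun i => j i (z i) q
  have hce : c i ≠ e i := fun h' => hqp (((h i).eq_base_iff _ _).1 h'.symm)
  have hcompl : ({Bouquet.incl e i (c i)}ᶜ : Set (Bouquet e)) = Bouquet.proj i ⁻¹' {c i}ᶜ := by
    ext f
    simp only [mem_compl_iff, mem_singleton_iff, mem_preimage, not_iff_not]
    constructor
    · rintro rfl
      simp
    · intro hf
      rw [← hf]
      exact (Bouquet.incl_proj_of_ne (hf ▸ hce)).symm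
  refine ⟨π i ∘ Bouquet.proj i, fun w => Bouquet.incl e i (j i w q), ?_,
    (Bouquet.continuous_incl i).comp ((h i).continuous_left q), fun w hw => ?_, fun w => ?_,
    fun w => ?_⟩
  · rw [hcompl]
    exact (h i).continuousOn.comp (Bouquet.continuous_proj i).continuousOn fun _ hf => hf
  · exact hqp (((h i).eq_base_iff _ _).1 ((Bouquet.isEmbedding_incl i).injective hw))
  · simp [(h i).proj w q hqp]
  · rw [hcompl, preimage_comp, ← preimage_inter, (h i).preimage_eq]
    exact Bouquet.isPreconnected_preimage_proj i
      ((hP p).image _ ((h i).continuous w).continuousOn)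

/-- The deleted point must be an apex: the base point contradicts compactness of `T`, any other
point its nontriviality. -/
theorem eq_of_isComplComponentSpace_bouquet [Infinite ι] [PathConnectedSpace P]
    (hP : ∀ x : P, IsPreconnected ({x}ᶜ : Set P)) (hqp : q ≠ p)
    (h : ∀ i, IsCollapse p (c i) (j i) (π i)) (z : ∀ i, Z i)
    [∀ i, TotallyDisconnectedSpace (Z i)]
    {T : Type u} [TopologicalSpace T] [CompactSpace T] [TotallyDisconnectedSpace T] [Nontrivial T]
    (hT : IsComplComponentSpace (Bouquet (fun i => j i (z i) q)) T) :
    ∃ i, Nonempty (Z i ≃ₜ T) := by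
  have := fun i => (h i).pathConnectedSpace
  have := fun i => (h i).hausdorff
  obtain ⟨x, f, s, hf, hs, hsx, hfs, hpre⟩ := hT
  by_cases hx : x = Bouquet.base _
  · exfalso
    subst hx
    obtain ⟨ν, hν, hopen⟩ := Bouquet.exists_index (e := fun i => j i (z i) q)
    let : TopologicalSpace ι := ⊥
    have : DiscreteTopology ι := ⟨rfl⟩
    have hνc : ContinuousOn ν {Bouquet.base _}ᶜ := by
      rw [isOpen_compl_singleton.continuousOn_iff]
      intro x hx
      rw [ContinuousAt, nhds_discrete ι, Filter.tendsto_pure]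
      exact Filter.mem_of_superset ((hopen (ν x)).mem_nhds ⟨hx, rfl⟩) fun y hy => hy.2
    -- Here compact `T` would map onto the infinite discrete space `ι`; the apexes witness
    -- surjectivity.
    have hsurj : Function.Surjective (ν ∘ s) := by
      intro i
      have hne : c i ≠ j i (z i) q := fun h' => hqp (((h i).eq_base_iff _ _).1 h'.symm)
      refine ⟨f (Bouquet.incl _ i (c i)), ?_⟩
      rw [Function.comp_apply, eq_of_isPreconnected_fibres hsx hfs hpre hνc, hν i _ hne]
      rw [← Bouquet.incl_base i]
      exact fun h' => hne ((Bouquet.isEmbedding_incl i).injective h')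
    have hcomp : CompactSpace ι := by
      refine ⟨?_⟩
      rw [← hsurj.range_eq]
      exact isCompact_range (hνc.comp_continuous hs hsx)
    exact not_finite_iff_infinite.2 ‹Infinite ι› (finite_of_compact_of_discrete)
  · obtain ⟨i, y, rfl⟩ := Bouquet.exists_incl x
    have hy : y ≠ j i (z i) q := by
      rintro rfl
      exact hx (Bouquet.incl_base (e := fun i => j i (z i) q) i)
    by_cases hyc : y = c i
    · subst hyc
      obtain ⟨f', s', hf', hs', hsx', hfs', hpre'⟩ :=
        isComplComponentSpace_bouquet hP hqp h z i
      -- Two component spaces of the same complement are identified through each other's sections.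
      refine ⟨i, ⟨⟨⟨f ∘ s', f' ∘ s, fun w => ?_, fun w => ?_⟩, hf.comp_continuous hs' hsx',
        hf'.comp_continuous hs hsx⟩⟩⟩
      · exact (eq_of_isPreconnected_fibres hsx hfs hpre hf' (hsx' w)).trans (hfs' w)
      · exact (eq_of_isPreconnected_fibres hsx' hfs' hpre' hf (hsx w)).trans (hfs w)
    · exfalso
      have hconn := Bouquet.isPreconnected_compl_singleton (e := fun i => j i (z i) q) i hy
        ((h i).isPreconnected_compl_singleton hP hyc)
      obtain ⟨t, t', htt⟩ := exists_pair_ne T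
      refine htt ?_
      rw [← hfs t, ← hfs t']
      exact (hconn.image f hf).subsingleton (mem_image_of_mem _ (hsx t))
        (mem_image_of_mem _ (hsx t'))

end Coding

-- The family of continua

theorem weight_prod_self_le {J : Type u} [TopologicalSpace J] [CompactSpace J] [T2Space J]
    {κ : Cardinal.{u}} (hκ : ℵ₀ ≤ κ) (hJ : weight J ≤ κ) : weight (J × J) ≤ κ := by
  refine weight_le_of_jointly_injective hκ (ι := ULift.{u} Bool) (Z := fun _ => J)
    ((mk_lt_aleph0).le.trans hκ) (fun _ => hJ) (fun i p => if i.down then p.1 else p.2)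
    (fun i => ?_) fun x y h => Prod.ext (by simpa using h ⟨true⟩) (by simpa using h ⟨false⟩)
  rcases i with ⟨_ | _⟩
  · simpa using continuous_snd
  · simpa using continuous_fst

section Family

variable {κ : Cardinal.{u}} {J : Type u} [TopologicalSpace J] {ι : Type u} {Z Y : ι → Type u}
  [∀ i, TopologicalSpace (Z i)] [∀ i, TopologicalSpace (Y i)] {p q : J × J} {c : ∀ i, Y i}
  {j : ∀ i, Z i → J × J → Y i} {π : ∀ i, Y i → Z i}

/-- The `κ` apexes form a relatively discrete set, bounding the weight below; weight is at most
size, so the size is at least `κ`. Horizontal slices of the blades are the copies of `J`. -/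
theorem isPathContinuum_bouquet (hκ : ℵ₀ ≤ κ) (hJ : IsContinuum J) [PathConnectedSpace J]
    (hι : #ι = κ) (hZ : ∀ i, #(Z i) ≤ κ) (hqp : q ≠ p)
    (h : ∀ i, IsCollapse p (c i) (j i) (π i)) (hw : ∀ i, weight (Y i) ≤ κ) (z : ∀ i, Z i) :
    IsPathContinuum κ (max κ #J) (Bouquet (fun i => j i (z i) q)) ∧
      ∀ x : Bouquet (fun i => j i (z i) q),
        ∃ f : J → Bouquet (fun i => j i (z i) q), IsEmbedding f ∧ x ∈ range f := by
  have := hJ.compact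
  have := hJ.hausdorff
  have := hJ.nontrivial
  have hJinf := hJ.infinite
  have := fun i => (h i).pathConnectedSpace
  have := fun i => (h i).hausdorff
  have := fun i => (h i).compact
  have : Nonempty ι := by
    rw [← mk_ne_zero_iff, hι]
    exact (aleph0_pos.trans_le hκ).ne'
  set e : ∀ i, Y i := fun i => j i (z i) q
  have hne : ∀ i, c i ≠ e i := fun i h' => hqp (((h i).eq_base_iff _ _).1 h'.symm)
  have hemb : ∀ x : Bouquet e, ∃ f : J → Bouquet e, IsEmbedding f ∧ x ∈ range f := by
    intro x
    obtain ⟨i, y, rfl⟩ := Bouquet.exists_incl x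
    obtain ⟨w, ⟨a, b⟩, rfl⟩ := (h i).surjective y
    have hc : Continuous fun a => Bouquet.incl e i (j i w (a, b)) :=
      (Bouquet.continuous_incl i).comp (((h i).continuous w).comp (by fun_prop))
    refine ⟨_, (hc.isClosedEmbedding fun a a' haa => ?_).isEmbedding, a, rfl⟩
    exact congrArg Prod.fst ((h i).injective w ((Bouquet.isEmbedding_incl i).injective haa))
  refine ⟨?_, hemb⟩
  obtain ⟨f, hf, -⟩ := hemb (Bouquet.base e)
  have hpath := Bouquet.pathConnectedSpace (e := e)
  have hcont : IsContinuum (Bouquet e) :=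
    ⟨Bouquet.compactSpace, inferInstance, inferInstance, hf.injective.nontrivial⟩
  have hweight : weight (Bouquet e) = κ :=
    le_antisymm (Bouquet.weight_le hκ hι.le hw)
      (hι ▸ Bouquet.card_le_weight fun i => ⟨c i, hne i⟩)
  refine ⟨hcont, hpath, hweight, le_antisymm ?_ (max_le ?_ (mk_le_of_injective hf.injective))⟩
  · have hsurj : Function.Surjective
        fun w : Σ i, Z i × (J × J) => Bouquet.incl e w.1 (j w.1 w.2.1 w.2.2) := by
      intro x
      obtain ⟨i, y, rfl⟩ := Bouquet.exists_incl x
      obtain ⟨w, a, rfl⟩ := (h i).surjective y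
      exact ⟨⟨i, w, a⟩, rfl⟩
    refine (mk_le_of_surjective hsurj).trans ?_
    rw [mk_sigma]
    have hmax : ℵ₀ ≤ max κ #J := hκ.trans (le_max_left _ _)
    have hi : ∀ i, #(Z i × (J × J)) ≤ max κ #J := fun i => by
      rw [← mul_def, ← mul_def, mul_eq_self (aleph0_le_mk J)]
      exact (mul_le_mul' ((hZ i).trans (le_max_left _ _)) (le_max_right _ _)).trans
        (mul_eq_self hmax).le
    refine (sum_le_sum _ _ hi).trans ?_
    rw [sum_const', hι]
    exact (mul_le_mul' (le_max_left _ _) le_rfl).trans (mul_eq_self hmax).le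
  · have := hcont.infinite
    have := hcont.compact
    exact hweight ▸ weight_le_card

end Family

theorem exists_nonhomeomorphic_continua {κ : Cardinal.{u}} (hκ : ℵ₀ ≤ κ) (J : Type u)
    [TopologicalSpace J] (hJ : IsContinuum J) (hpath : PathConnectedSpace J)
    (hw : weight J ≤ κ) :
    ∃ (I : Type u) (X : I → Type u) (_ : ∀ i, TopologicalSpace (X i)),
      #I = 2 ^ κ ∧ MutuallyNonHomeomorphic X ∧
      (∀ i, IsPathContinuum κ (max κ #J) (X i)) ∧
      (Balanced J → weight J = κ → ∀ i, Balanced (X i)) := by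
  have := hJ.compact
  have := hJ.hausdorff
  have := hJ.nontrivial
  have hJinf := hJ.infinite
  let K := κ.out
  have hK : #K = κ := mk_out κ
  have hL : #(K ⊕ K) = κ := by rw [← add_def, hK, add_eq_self hκ]
  obtain ⟨Z, tZ, hZ, hZne⟩ := exists_nonhomeomorphic_totallyDisconnected hκ (K ⊕ K) hL.le
  have := fun i => (hZ i).1
  have := fun i => (hZ i).2.1
  have := fun i => (hZ i).2.2.1
  have := fun i => (hZ i).2.2.2.1
  have hZc := fun i => (hZ i).2.2.2.2
  obtain ⟨p, q, hpq⟩ := exists_pair_ne (J × J)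
  choose Y tY c j π h hYw using fun i =>
    exists_isCollapse (Z := Z i) hκ (hZc i) (weight_prod_self_le hκ hw) p
  let z : ∀ i, Z i := fun i => Classical.arbitrary _
  -- The right copy of `K` codes `B`; the full left copy makes every index set have size exactly
  -- `κ`.
  let A : Set K → Set (K ⊕ K) := fun B => range Sum.inl ∪ Sum.inr '' B
  have hA : ∀ B, #(A B) = κ := fun B => by
    refine le_antisymm ((mk_set_le _).trans hL.le) ?_
    rw [← hK, ← mk_range_eq (Sum.inl : K → K ⊕ K) Sum.inl_injective]
    exact mk_le_mk_of_subset subset_union_left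
  have hAinf : ∀ B, Infinite (A B) := fun B => by rw [infinite_iff, hA]; exact hκ
  let X : Set K → Type u := fun B => Bouquet (fun i : A B => j i (z i) q)
  have hX := fun B => isPathContinuum_bouquet hκ hJ (hA B) (fun i => hZc i.1) hpq.symm
    (fun i : A B => h i) (fun i => hYw i.1) (fun i => z i)
  refine ⟨Set K, X, fun B => inferInstance, by rw [mk_set, hK], ?_, fun B => (hX B).1, ?_⟩
  · intro B B' hne
    refine ⟨fun hh => hne ?_⟩
    have key : ∀ B B', (X B ≃ₜ X B') → A B ⊆ A B' := by
      intro B B' hh i hi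
      have h1 : IsComplComponentSpace (X B) (Z i) :=
        ⟨_, isComplComponentSpace_bouquet isPreconnected_compl_singleton_prod hpq.symm
          (fun i : A B => h i) (fun i => z i) ⟨i, hi⟩⟩
      obtain ⟨i', ⟨hi'⟩⟩ := eq_of_isComplComponentSpace_bouquet
        isPreconnected_compl_singleton_prod hpq.symm (fun i : A B' => h i) (fun i => z i)
        (h1.congr hh)
      exact hZne _ _ ⟨hi'⟩ ▸ i'.2
    have hAB : A B = A B' := Subset.antisymm (key _ _ hh) (key _ _ hh.symm)
    ext k
    have : Sum.inr k ∈ A B ↔ Sum.inr k ∈ A B' := by rw [hAB]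
    simpa [A] using this
  · intro hbal hwJ B
    refine hbal.of_embeddings ?_ ?_ (hX B).2
    · rw [(hX B).1.size_eq, max_eq_right]
      exact hwJ ▸ weight_le_card
    · rw [(hX B).1.weight_eq, hwJ]

-- Tychonoff cubes

section Cube

theorem weight_cube_le {κ : Cardinal.{u}} (hκ : ℵ₀ ≤ κ) {K : Type u} (hK : #K ≤ κ) :
    weight (K → unitInterval) ≤ κ := by
  refine weight_le_of_jointly_injective hκ hK (Z := fun _ => ULift.{u} unitInterval) (fun _ => ?_)
    (fun k f => ULift.up (f k)) (fun k => continuous_uliftUp.comp (continuous_apply k))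
    fun f g h => funext fun k => ULift.up_injective (h k)
  obtain ⟨B, hBc, -, hB⟩ := exists_countable_basis (ULift.{u} unitInterval)
  exact (weight_le_of_isTopologicalBasis hB).trans ((mk_le_aleph0_iff.2 hBc.to_subtype).trans hκ)

theorem card_le_weight_cube (K : Type u) : #K ≤ weight (K → unitInterval) := by
  classical
  refine card_le_weight (fun k => Pi.single k 1) (fun k => (fun f => f k) ⁻¹' {0}ᶜ)
    (fun k => isOpen_compl_singleton.preimage (continuous_apply k)) fun k l => ?_
  rw [mem_preimage, mem_compl_iff, mem_singleton_iff]
  constructor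
  · intro h
    by_contra hkl
    exact h (Pi.single_eq_of_ne hkl _)
  · rintro rfl
    simp

theorem weight_cube {K : Type u} [Infinite K] : weight (K → unitInterval) = #K :=
  le_antisymm (weight_cube_le (aleph0_le_mk K) le_rfl) (card_le_weight_cube K)

theorem card_cube {K : Type u} [Infinite K] : #(K → unitInterval) = 2 ^ #K := by
  have hI : #unitInterval = continuum := mk_Icc_real zero_lt_one
  rw [mk_pi, prod_const, hI, lift_continuum, lift_uzero, continuum, ← power_mul,
    aleph0_mul_eq (aleph0_le_mk K)]

theorem pathConnectedSpace_cube (K : Type u) : PathConnectedSpace (K → unitInterval) := by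
  have : PathConnectedSpace unitInterval := isPathConnected_iff_pathConnectedSpace.1
    ((convex_Icc (0 : ℝ) 1).isPathConnected ⟨0, by simp⟩)
  infer_instance

theorem isContinuum_cube {K : Type u} [Nonempty K] : IsContinuum (K → unitInterval) :=
  ⟨inferInstance, inferInstance, inferInstance, inferInstance⟩

/-- A nonempty open set contains a cube over all but finitely many coordinates, the remaining ones
being frozen. -/
theorem balanced_cube {K : Type u} [Infinite K] : Balanced (K → unitInterval) := by
  classical
  have key : ∀ U : Set (K → unitInterval), IsOpen U → U.Nonempty →
      2 ^ #K ≤ #U ∧ #K ≤ weight U := by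
    rintro U hU ⟨f, hf⟩
    obtain ⟨F, u, hu, hFU⟩ := isOpen_pi_iff.1 hU f hf
    let L : Type u := {k // k ∉ F}
    have hLK : #L = #K := mk_compl_finset_of_infinite F
    have hLinf : Infinite L := by rw [infinite_iff, hLK]; exact aleph0_le_mk K
    let φ : (L → unitInterval) → U := fun g =>
      ⟨fun k => if hk : k ∈ F then f k else g ⟨k, hk⟩, hFU fun k hk => by
        rw [dif_pos (Finset.mem_coe.1 hk)]
        exact (hu k hk).2⟩
    have hφ : Continuous φ := by
      refine Continuous.subtype_mk (continuous_pi fun k => ?_) _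
      by_cases hk : k ∈ F
      · simp only [hk, dif_pos]
        fun_prop
      · simp only [hk, dif_neg, not_false_iff]
        fun_prop
    have hinj : Function.Injective φ := by
      intro g g' h
      funext k
      have := congrFun (congrArg Subtype.val h) k.1
      simpa [φ, k.2] using this
    rw [← hLK]
    exact ⟨card_cube.symm.trans_le (mk_le_of_injective hinj),
      weight_cube.symm.trans_le <| weight_le_of_isInducing (hφ.isClosedEmbedding hinj).isInducing⟩
  refine ⟨inferInstance, fun U hU hne => ?_, fun U hU hne => ?_⟩
  · exact le_antisymm (mk_set_le U) (card_cube.trans_le (key U hU hne).1)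
  · exact le_antisymm (weight_le_of_isInducing IsInducing.subtypeVal)
      (weight_cube.trans_le (key U hU hne).2)

/-- The coordinates are Urysohn functions for pairs of basic sets with disjoint closures, and `0`
for the other pairs. -/
theorem exists_isClosedEmbedding_cube {X : Type u} [TopologicalSpace X] [CompactSpace X]
    [T2Space X] {K : Type u} [Infinite K] (hw : weight X = #K) :
    ∃ f : X → K → unitInterval, IsClosedEmbedding f := by
  obtain ⟨B, hB, hBc⟩ := exists_basis_card_eq_weight X
  have hBB : #K = #(B × B) := by
    rw [← mul_def, hBc, hw, mul_eq_self (aleph0_le_mk K)]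
  obtain ⟨e⟩ := Cardinal.eq.1 hBB
  have hur : ∀ b : B × B, ∃ f : X → unitInterval, Continuous f ∧
      (Disjoint (closure b.1.1) (closure b.2.1) → EqOn f 0 (closure b.1.1) ∧
        EqOn f 1 (closure b.2.1)) := by
    intro b
    by_cases hd : Disjoint (closure b.1.1) (closure b.2.1)
    · obtain ⟨f, h0, h1, hf⟩ := exists_continuous_zero_one_of_isClosed isClosed_closure
        isClosed_closure hd
      refine ⟨fun x => ⟨f x, hf x⟩, f.continuous.subtype_mk _, fun _ => ⟨fun x hx => ?_,
        fun x hx => ?_⟩⟩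
      · exact Subtype.ext (h0 hx)
      · exact Subtype.ext (h1 hx)
    · exact ⟨fun _ => 0, continuous_const, fun h => absurd h hd⟩
  choose f hf hf' using hur
  refine ⟨fun x k => f (e k) x, (continuous_pi fun k => hf _).isClosedEmbedding fun x y hxy => ?_⟩
  by_contra hne
  obtain ⟨U, hxU, hU, V, hyV, hV, hd⟩ := exists_open_nhds_disjoint_closure hne
  obtain ⟨U', hU', hxU', hUU'⟩ := hB.exists_subset_of_mem_open hxU hU
  obtain ⟨V', hV', hyV', hVV'⟩ := hB.exists_subset_of_mem_open hyV hV
  have hd' := hd.mono (closure_mono hUU') (closure_mono hVV')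
  obtain ⟨h0, h1⟩ := hf' (⟨U', hU'⟩, ⟨V', hV'⟩) hd'
  have h := congrFun hxy (e.symm (⟨U', hU'⟩, ⟨V', hV'⟩))
  simp only [e.apply_symm_apply] at h
  rw [h0 (subset_closure hxU'), h1 (subset_closure hyV')] at h
  exact zero_ne_one h

/-- A closed set is determined by the basic sets that miss it. -/
theorem card_closeds_le (X : Type u) [TopologicalSpace X] :
    #{C : Set X // IsClosed C} ≤ 2 ^ weight X := by
  obtain ⟨B, hB, hBc⟩ := exists_basis_card_eq_weight X
  rw [← hBc, ← mk_set]
  refine mk_le_of_injective (f := fun C => {b : B | b.1 ⊆ C.1ᶜ}) fun C C' h => ?_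
  have key : ∀ C C' : {C : Set X // IsClosed C},
      {b : B | b.1 ⊆ C.1ᶜ} = {b : B | b.1 ⊆ C'.1ᶜ} → C'.1 ⊆ C.1 := by
    intro C C' h x hx
    by_contra hxC
    obtain ⟨b, hb, hxb, hbC⟩ := hB.exists_subset_of_mem_open hxC C.2.isOpen_compl
    have : (⟨b, hb⟩ : B) ∈ {b : B | b.1 ⊆ C'.1ᶜ} := h ▸ hbC
    exact this hxb hx
  exact Subtype.ext (Subset.antisymm (key _ _ h.symm) (key _ _ h))

end Cube

-- Homeomorphism invariance and representatives

section Transport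

variable {X Y : Type u} [TopologicalSpace X] [TopologicalSpace Y]

theorem IsPathContinuum.of_homeomorph {κ lam : Cardinal.{u}} (h : X ≃ₜ Y)
    (hX : IsPathContinuum κ lam X) : IsPathContinuum κ lam Y := by
  have := hX.continuum.compact
  have := hX.continuum.hausdorff
  have := hX.continuum.nontrivial
  have := hX.pathConnected
  have hpath : PathConnectedSpace Y := h.surjective.pathConnectedSpace h.continuous
  exact ⟨⟨h.compactSpace, h.t2Space, inferInstance, h.injective.nontrivial⟩, hpath,
    (weight_eq_of_homeomorph h).symm.trans hX.weight_eq,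
    (mk_congr h.symm.toEquiv).trans hX.size_eq⟩

theorem Balanced.of_homeomorph (h : X ≃ₜ Y) (hX : Balanced X) : Balanced Y :=
  hX.of_embeddings (mk_congr h.symm.toEquiv) (weight_eq_of_homeomorph h.symm)
    fun y => ⟨h, h.isEmbedding, h.symm y, h.apply_symm_apply y⟩

end Transport

/-- A homeomorphism-invariant class of compact Hausdorff spaces of weight `κ` having `2 ^ κ`
mutually non-homeomorphic members has a complete system of representatives of size `2 ^ κ`. -/
theorem exists_representatives {κ : Cardinal.{u}} (hκ : ℵ₀ ≤ κ)
    (Q : ∀ (X : Type u) [TopologicalSpace X], Prop)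
    (hQ : ∀ (X : Type u) [TopologicalSpace X], Q X →
      CompactSpace X ∧ T2Space X ∧ weight X = κ)
    (hQh : ∀ (X Y : Type u) [TopologicalSpace X] [TopologicalSpace Y], (X ≃ₜ Y) → Q X → Q Y)
    {I' : Type u} (hI' : #I' = 2 ^ κ) (X' : I' → Type u) [∀ i, TopologicalSpace (X' i)]
    (hX' : MutuallyNonHomeomorphic X') (hX'Q : ∀ i, Q (X' i)) :
    ∃ (I : Type u) (X : I → Type u) (_ : ∀ i, TopologicalSpace (X i)),
      #I = 2 ^ κ ∧ MutuallyNonHomeomorphic X ∧ (∀ i, Q (X i)) ∧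
      ∀ (Y : Type u) [TopologicalSpace Y], Q Y → ∃ i, Nonempty (Y ≃ₜ X i) := by
  let K := κ.out
  have hK : #K = κ := mk_out κ
  have hKinf : Infinite K := by rw [infinite_iff, hK]; exact hκ
  -- Working inside the cube makes the homeomorphism classes a quotient of a type with at most `2 ^
  -- κ` elements.
  let S := {C : {C : Set (K → unitInterval) // IsClosed C} // Q C.1}
  let r : Setoid S :=
    { r := fun C D => Nonempty (C.1.1 ≃ₜ D.1.1)
      iseqv := ⟨fun _ => ⟨Homeomorph.refl _⟩, fun ⟨h⟩ => ⟨h.symm⟩, fun ⟨h⟩ ⟨h'⟩ => ⟨h.trans h'⟩⟩ }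
  have hrep : ∀ (Y : Type u) [TopologicalSpace Y], Q Y → ∃ C : S, Nonempty (Y ≃ₜ C.1.1) := by
    intro Y _ hY
    obtain ⟨hc, ht, hw⟩ := hQ Y hY
    obtain ⟨f, hf⟩ := exists_isClosedEmbedding_cube (hw.trans hK.symm)
    exact ⟨⟨⟨range f, hf.isClosed_range⟩, hQh _ _ hf.isEmbedding.toHomeomorph hY⟩,
      ⟨hf.isEmbedding.toHomeomorph⟩⟩
  refine ⟨Quotient r, fun i => i.out.1.1, fun i => inferInstance, le_antisymm ?_ ?_, ?_,
    fun i => i.out.2, ?_⟩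
  · refine mk_quotient_le.trans ((mk_subtype_le _).trans ((card_closeds_le _).trans ?_))
    rw [weight_cube, hK]
  · rw [← hI']
    choose C hC using fun i => hrep (X' i) (hX'Q i)
    refine mk_le_of_injective (f := fun i => (⟦C i⟧ : Quotient r)) fun i k hik => ?_
    by_contra hne
    obtain ⟨h⟩ := Quotient.exact hik
    obtain ⟨h1⟩ := hC i
    obtain ⟨h2⟩ := hC k
    exact (hX' i k hne).false (h1.trans (h.trans h2.symm))
  · intro i k hik
    refine ⟨fun h => hik ?_⟩
    rw [← Quotient.out_eq i, ← Quotient.out_eq k]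
    exact Quotient.sound ⟨h⟩
  · intro Y _ hY
    obtain ⟨C, ⟨h⟩⟩ := hrep Y hY
    obtain ⟨h'⟩ := Quotient.exact (Quotient.out_eq (⟦C⟧ : Quotient r)).symm
    exact ⟨⟦C⟧, ⟨h.trans h'⟩⟩

end CountingContinua

theorem theorem18 (κ : Cardinal.{u}) (hκ : ℵ₀ ≤ κ) :
    (∀ (J : Type u) [TopologicalSpace J],
      CountingContinua.IsContinuum J → PathConnectedSpace J → CountingContinua.weight J ≤ κ →
      ∃ (I : Type u) (X : I → Type u) (_ : ∀ i, TopologicalSpace (X i)),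
        #I = 2 ^ κ ∧
        CountingContinua.MutuallyNonHomeomorphic X ∧
        (∀ i, CountingContinua.IsPathContinuum κ (max κ #J) (X i)) ∧
        (CountingContinua.Balanced J → CountingContinua.weight J = κ →
          ∀ i, CountingContinua.Balanced (X i))) ∧
    -- a complete system of representatives, of cardinality `2 ^ κ`, up to homeomorphism
    (∃ (I : Type u) (X : I → Type u) (_ : ∀ i, TopologicalSpace (X i)),
      #I = 2 ^ κ ∧
      CountingContinua.MutuallyNonHomeomorphic X ∧
      (∀ i, CountingContinua.IsPathContinuum κ (2 ^ κ) (X i) ∧ CountingContinua.Balanced (X i)) ∧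
      ∀ (Y : Type u) [TopologicalSpace Y],
        CountingContinua.IsPathContinuum κ (2 ^ κ) Y → CountingContinua.Balanced Y →
        ∃ i, Nonempty (Y ≃ₜ X i)) := by
  refine ⟨fun J _ => CountingContinua.exists_nonhomeomorphic_continua hκ J, ?_⟩
  have hK : #κ.out = κ := mk_out κ
  have hKinf : Infinite κ.out := by rw [infinite_iff, hK]; exact hκ
  have hw : CountingContinua.weight (κ.out → unitInterval) = κ :=
    CountingContinua.weight_cube.trans hK
  obtain ⟨I', X', tX', hI', hX', hX'c, hX'b⟩ :=
    CountingContinua.exists_nonhomeomorphic_continua hκ (κ.out → unitInterval)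
      CountingContinua.isContinuum_cube (CountingContinua.pathConnectedSpace_cube _) hw.le
  rw [CountingContinua.card_cube, hK, max_eq_right (cantor κ).le] at hX'c
  obtain ⟨I, X, tX, hI, hX, hXQ, hrep⟩ := CountingContinua.exists_representatives hκ
    (fun X _ => CountingContinua.IsPathContinuum κ (2 ^ κ) X ∧ CountingContinua.Balanced X)
    (fun X _ h => ⟨h.1.continuum.compact, h.1.continuum.hausdorff, h.1.weight_eq⟩)
    (fun X Y _ _ e h => ⟨h.1.of_homeomorph e, h.2.of_homeomorph e⟩) hI' X' hX'
    (fun i => ⟨hX'c i, hX'b CountingContinua.balanced_cube hw i⟩)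
  exact ⟨I, X, tX, hI, hX, hXQ, fun Y _ h1 h2 => hrep Y ⟨h1, h2⟩⟩
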